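/- **Theorem (PBPO$^{+}$ models DPO).** Let $\mathcal C$ be a quasitopos: a category with finite limits and finite colimits that is locally cartesian closed and has a regular-subobject classifier. Let $\mathcal M$ be the class of regular monomorphisms of $\mathcal C$. *Definitions.* An $\mathcal M$-partial map classifier is a functor $T:\mathcal C\to\mathcal C$ with a natural transformation $\eta:\mathrm{id}\to T$ whose components lie in $\mathcal M$, such that for every $m:X\to A$ in $\mathcal M$ and every $f:X\to B$ there is a unique $\varphi:A\to T(B)$ for which the square $\varphi\circ m=\eta_B\circ f$ is a pullback. A DPO rule $\rho$ is a span $L\xleftarrow{\,l\,}K\xrightarrow{\,r\,}R$ with $l\in\mathcal M$ and $r$ arbitrary. For $m:L\to G_L$, a DPO step $G_L\Rightarrow^{\rho,m}_{\mathrm{DPO}}G_R$ exists if there are $u:K\to G_K$, $g_L:G_K\to G_L$, $g_R:G_K\to G_R$ and $w:R\to G_R$ such that $m\circ l=g_L\circ u$ and $g_R\circ u=w\circ r$ are pushout squares. A PBPO$^{+}$ rule $\tau$ is a span $L\xleftarrow{\,l\,}K\xrightarrow{\,r\,}R$ with morphisms $t_L:L\to L'$, $t_K:K\to K'$, $l':K'\to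 L'$ such that $t_L\circ l=l'\circ t_K$ is a pullback square. For $m:L\to G_L$, a PBPO$^{+}$ step $G_L\Rightarrow^{\tau,m}_{\mathrm{PBPO}^{+}}G_R$ exists if there is $\alpha:G_L\to L'$ such that $\alpha\circ m=t_L\circ \mathrm{id}_L$ is a pullback square, and there are a pullback square $\alpha\circ g_L=l'\circ u'$ with $g_L:G_K\to G_L$, $u':G_K\to K'$, the (unique) $u:K\to G_K$ with $t_K=u'\circ u$, and a pushout square $g_R\circ u=w\circ r$ with $g_R:G_K\to G_R$, $w:R\to G_R$. *Claim.* The encoding of DPO rules as PBPO$^{+}$ rules is well-defined in $\mathcal C$: $\mathcal M$ contains all isomorphisms and is closed under composition and pullback; an $\mathcal M$-partial map classifier exists; pushouts along $\mathcal M$-morphisms exist and are pullbacks, and $\mathcal M$ is stable under pushout. Hence, for every $\mathcal M$-partial map classifier $(T,\eta)$ and every DPO rule $\rho$, the pushout $L\xrightarrow{t_L}L'\xleftarrow{\,l'\,}T(K)$ of $l$ along $\eta_K:K\to T(K)$ exists, and for every choice of this pushout $t_L$ and $l'$ are regular monomorphisms and the span $L\xleftarrow{\,l\,}K\xrightarrow{\,r\,}R$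 together with $t_L$, $t_K=\eta_K$ and $l'$ is a PBPO$^{+}$ rule $[\![\rho]\!]$. Moreover, for every regular monomorphism $m:L\to G_L$ and every object $G_R$, $$G_L\Rightarrow^{\rho,m}_{\mathrm{DPO}}G_R\iff G_L\Rightarrow^{[\![\rho]\!],m}_{\mathrm{PBPO}^{+}}G_R .$$ -/

import Mathlib

open CategoryTheory CategoryTheory.Limits

universe v u

/-- A quasitopos: finite limits and finite colimits, local cartesian closure (every pullback
functor `C/Y ⥤ C/X` has a right adjoint), and a regular-subobject classifier `⊤_ C ⟶ Ω`. -/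
class Quasitopos (C : Type u) [Category.{v} C] : Prop where
  hasFiniteLimits : HasFiniteLimits C
  hasFiniteColimits : HasFiniteColimits C
  pullback_isLeftAdjoint :
    ∀ ⦃X Y : C⦄ (f : X ⟶ Y), (Over.pullback f).IsLeftAdjoint
  exists_regularSubobjectClassifier :
    ∃ (Ω : C) (truth : ⊤_ C ⟶ Ω), ∀ ⦃U X : C⦄ (m : U ⟶ X), IsRegularMono m →
      ∃! χ : X ⟶ Ω, IsPullback m (terminal.from U) χ truth

/-- A stable system of monics: a class of monomorphisms that contains all isomorphisms and is
closed under composition and pullback. -/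
structure IsStableSystemOfMonics {C : Type u} [Category.{v} C] (M : MorphismProperty C) :
    Prop where
  mono : ∀ ⦃X Y : C⦄ (f : X ⟶ Y), M f → Mono f
  of_isIso : ∀ ⦃X Y : C⦄ (f : X ⟶ Y), IsIso f → M f
  comp : ∀ ⦃X Y Z : C⦄ (f : X ⟶ Y) (g : Y ⟶ Z), M f → M g → M (f ≫ g)
  of_isPullback : ∀ ⦃A B D E : C⦄ ⦃m' : A ⟶ D⦄ ⦃f' : A ⟶ B⦄ ⦃f : D ⟶ E⦄ ⦃m : B ⟶ E⦄,
    IsPullback m' f' f m → M m → M m'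

/-- An `M`-partial map classifier `(T, η)`. -/
structure PartialMapClassifier {C : Type u} [Category.{v} C] (M : MorphismProperty C) where
  T : C ⥤ C
  η : 𝟭 C ⟶ T
  η_mem : ∀ X : C, M (η.app X)
  existsUnique : ∀ ⦃X A B : C⦄ (m : X ⟶ A) (f : X ⟶ B), M m →
    ∃! φ : A ⟶ T.obj B, IsPullback f m (η.app B) φ

/-- A DPO rewrite rule `L ↩ K ⟶ R`, with left leg in `M` and arbitrary right leg. -/
structure DPORule {C : Type u} [Category.{v} C] (M : MorphismProperty C) where
  {L K R : C}
  l : K ⟶ L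
  r : K ⟶ R
  l_mem : M l

/-- `ρ.Step m G_R`: there is a DPO rewrite step from `G_L` to `G_R` with rule `ρ` and match `m`. -/
def DPORule.Step {C : Type u} [Category.{v} C] {M : MorphismProperty C} (ρ : DPORule M)
    {G_L : C} (m : ρ.L ⟶ G_L) (G_R : C) : Prop :=
  ∃ (G_K : C) (u : ρ.K ⟶ G_K) (gL : G_K ⟶ G_L) (gR : G_K ⟶ G_R) (w : ρ.R ⟶ G_R),
    IsPushout ρ.l u m gL ∧ IsPushout u ρ.r gR w

/-- A PBPO⁺ rewrite rule: a span `L ⟵ K ⟶ R` with typings `tL : L ⟶ L'` and `tK : K ⟶ K'` and a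
morphism `l' : K' ⟶ L'` such that the resulting square is a pullback. -/
structure PBPOPlusRule (C : Type u) [Category.{v} C] where
  {L K R L' K' : C}
  l : K ⟶ L
  r : K ⟶ R
  tL : L ⟶ L'
  tK : K ⟶ K'
  l' : K' ⟶ L'
  isPullback : IsPullback l tK tL l'

/-- `m` and `α` form a strong match for the context typing `tL`. -/
def IsStrongMatch {C : Type u} [Category.{v} C] {L L' G_L : C} (tL : L ⟶ L')
    (m : L ⟶ G_L) (α : G_L ⟶ L') : Prop :=
  IsPullback m (𝟙 L) α tL

/-- `ρ.StepVia m α G_R`: there is a PBPO⁺ rewrite step from `G_L` to `G_R` with rule `ρ`, match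
morphism `m` and adherence morphism `α`. The equation `u ≫ u' = tK` determines `u`, because the
square with sides `𝟙 K`, `u`, `u'`, `tK` is a pullback. -/
def PBPOPlusRule.StepVia {C : Type u} [Category.{v} C] (ρ : PBPOPlusRule C)
    {G_L : C} (m : ρ.L ⟶ G_L) (α : G_L ⟶ ρ.L') (G_R : C) : Prop :=
  IsStrongMatch ρ.tL m α ∧
    ∃ (G_K : C) (gL : G_K ⟶ G_L) (u' : G_K ⟶ ρ.K') (u : ρ.K ⟶ G_K) (gR : G_K ⟶ G_R) (w : ρ.R ⟶ G_R),
      IsPullback gL u' α ρ.l' ∧ u ≫ u' = ρ.tK ∧ IsPushout u ρ.r gR w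

/-- `ρ.Step m G_R`: there is a PBPO⁺ rewrite step from `G_L` to `G_R` with rule `ρ` and match
morphism `m`, for some adherence morphism. -/
def PBPOPlusRule.Step {C : Type u} [Category.{v} C] (ρ : PBPOPlusRule C)
    {G_L : C} (m : ρ.L ⟶ G_L) (G_R : C) : Prop :=
  ∃ α : G_L ⟶ ρ.L', ρ.StepVia m α G_R

/-- The setting in which DPO rules with left leg in `M` are encoded as PBPO⁺ rules: `M` is a stable
system of monics that has a partial map classifier, and pushouts along `M`-morphisms exist, are
pullbacks, and preserve membership in `M`. -/
structure AdmitsDPOEncoding {C : Type u} [Category.{v} C] (M : MorphismProperty C) : Prop where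
  isStableSystemOfMonics : IsStableSystemOfMonics M
  nonempty_classifier : Nonempty (PartialMapClassifier M)
  hasPushout : ∀ ⦃X Y Z : C⦄ (m : X ⟶ Y) (f : X ⟶ Z), M m → HasPushout m f
  isPullback_of_isPushout : ∀ ⦃X Y Z P : C⦄ ⦃m : X ⟶ Y⦄ ⦃f : X ⟶ Z⦄ ⦃f' : Y ⟶ P⦄ ⦃m' : Z ⟶ P⦄,
    IsPushout m f f' m' → M m → IsPullback m f f' m'
  mem_of_isPushout : ∀ ⦃X Y Z P : C⦄ ⦃m : X ⟶ Y⦄ ⦃f : X ⟶ Z⦄ ⦃f' : Y ⟶ P⦄ ⦃m' : Z ⟶ P⦄,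
    IsPushout m f f' m' → M m → M m'

/-- The PBPO⁺ encoding of a DPO rule `ρ`: the interface typing is `η_K : K ⟶ T K`, and the type
graph `L'` with `tL : L ⟶ L'` and `l' : T K ⟶ L'` is a pushout of `l` along `η_K`. -/
def DPORule.toPBPOPlus {C : Type u} [Category.{v} C] {M : MorphismProperty C}
    (h : AdmitsDPOEncoding M) (c : PartialMapClassifier M) (ρ : DPORule M)
    {L' : C} {tL : ρ.L ⟶ L'} {l' : c.T.obj ρ.K ⟶ L'}
    (po : IsPushout ρ.l (c.η.app ρ.K) tL l') : PBPOPlusRule C where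
  L := ρ.L
  K := ρ.K
  R := ρ.R
  L' := L'
  K' := c.T.obj ρ.K
  l := ρ.l
  r := ρ.r
  tL := tL
  tK := c.η.app ρ.K
  l' := l'
  isPullback := h.isPullback_of_isPushout po ρ.l_mem

/-! Two facts carry the proof: pushouts are stable under pullback, since pullback functors are left
adjoints, and partial maps with regular mono domain are classified. The classifier of `B` comes from
pushing `B ⟶ ⊤_ C` forward along `truth`. Classifying suitable partial maps gives closure of regular
monos under composition and pushout, and shows that pushouts along them are pullbacks.

From DPO to PBPO⁺: `u` is a pullback of `m`, hence regular mono; classifying the partial map `(u, 𝟙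
K)` gives `u'`, and the pushout `G_L` then induces `α`. Conversely, pulling the pushout `L'` back
along `α` yields the left DPO square. The right-hand pushout is the same in both steps. -/

namespace CategoryTheory

/-! ### Stability of pushouts under pullback -/

section StablePushouts

variable {C : Type u} [Category.{v} C] [HasFiniteLimits C]

theorem Over.pullback_map_left_fst {Y Z : C} (a : Y ⟶ Z) {A B : Over Z} (g : A ⟶ B) :
    ((Over.pullback a).map g).left ≫ pullback.fst B.hom a = pullback.fst A.hom a ≫ g.left :=
  pullback.lift_fst _ _ _

theorem Over.pullback_map_left_snd {Y Z : C} (a : Y ⟶ Z) {A B : Over Z} (g : A ⟶ B) :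
    ((Over.pullback a).map g).left ≫ pullback.snd B.hom a = pullback.snd A.hom a :=
  pullback.lift_snd _ _ _

/-- A pullback square identifies its left leg with the value of the pullback functor. -/
noncomputable def Over.pullbackObjIso {Y Z : C} {a : Y ⟶ Z} {X : Over Z} {P : C} {l : P ⟶ X.left}
    {h : P ⟶ Y} (sq : IsPullback l h X.hom a) : (Over.pullback a).obj X ≅ Over.mk h :=
  Over.isoMk sq.isoPullback.symm sq.isoPullback_inv_snd

theorem Over.pullback_map_comp_pullbackObjIso_hom {Y Z : C} {a : Y ⟶ Z} {X X' : Over Z} (g : X ⟶ X')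
    {P P' : C} {l : P ⟶ X.left} {h : P ⟶ Y} {l' : P' ⟶ X'.left} {h' : P' ⟶ Y}
    (sq : IsPullback l h X.hom a) (sq' : IsPullback l' h' X'.hom a) (k : Over.mk h ⟶ Over.mk h')
    (hk : k.left ≫ l' = l ≫ g.left) :
    (Over.pullback a).map g ≫ (Over.pullbackObjIso sq').hom =
      (Over.pullbackObjIso sq).hom ≫ k := by
  have e : (Over.pullbackObjIso sq).hom.left = sq.isoPullback.inv := rfl
  have e' : (Over.pullbackObjIso sq').hom.left = sq'.isoPullback.inv := rfl
  have hk' : k.left ≫ h' = h := Over.w k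
  ext
  rw [Over.comp_left, Over.comp_left]
  refine sq'.hom_ext ?_ ?_
  · rw [Category.assoc, Category.assoc, e, e', hk, sq'.isoPullback_inv_fst,
      Over.pullback_map_left_fst, sq.isoPullback_inv_fst_assoc]
  · rw [Category.assoc, Category.assoc, e, e', hk', sq'.isoPullback_inv_snd,
      Over.pullback_map_left_snd, sq.isoPullback_inv_snd]

/-- If pulling back along `a` is a left adjoint, then pushouts over the codomain of `a` are stable
under pullback along `a`. -/
theorem IsPushout.of_isPullback_of_isLeftAdjoint {Y Z : C} (a : Y ⟶ Z)
    (ha : (Over.pullback a).IsLeftAdjoint) {K L M K' L' M' : C}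
    {f : K ⟶ L} {g : K ⟶ M} {h : L ⟶ Z} {i : M ⟶ Z} (po : IsPushout f g h i)
    {f' : K' ⟶ L'} {g' : K' ⟶ M'} {h' : L' ⟶ Y} {i' : M' ⟶ Y}
    {k : K' ⟶ K} {l : L' ⟶ L} {m : M' ⟶ M}
    (hK : IsPullback k (f' ≫ h') (f ≫ h) a) (hL : IsPullback l h' h a) (hM : IsPullback m i' i a)
    (w : f' ≫ h' = g' ≫ i') (wf : f' ≫ l = k ≫ f) (wg : g' ≫ m = k ≫ g) :
    IsPushout f' g' h' i' := by
  -- The pushout lives over its own vertex `Z`, where the left adjoint `Over.pullback a` can be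
  -- applied to it.
  have po' : IsPushout (Over.homMk f : Over.mk (f ≫ h) ⟶ Over.mk h)
      (Over.homMk g (by simpa using po.w.symm) : Over.mk (f ≫ h) ⟶ Over.mk i)
      (Over.homMk h : Over.mk h ⟶ Over.mk (𝟙 Z)) (Over.homMk i : Over.mk i ⟶ Over.mk (𝟙 Z)) := by
    refine IsPushout.of_map (Over.forget Z) ?_ ?_
    · ext; simpa using po.w
    · simpa using po
  have hZ : IsPullback a (𝟙 Y) (Over.mk (𝟙 Z)).hom a := IsPullback.of_id_snd
  have po'' := (po'.map (Over.pullback a)).of_iso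
    (Over.pullbackObjIso hK) (Over.pullbackObjIso hL) (Over.pullbackObjIso hM)
    (Over.pullbackObjIso hZ)
    (Over.pullback_map_comp_pullbackObjIso_hom _ hK hL (Over.homMk f') wf)
    (Over.pullback_map_comp_pullbackObjIso_hom _ hK hM (Over.homMk g' w.symm) wg)
    (Over.pullback_map_comp_pullbackObjIso_hom _ hL hZ (Over.homMk h') hL.w.symm)
    (Over.pullback_map_comp_pullbackObjIso_hom _ hM hZ (Over.homMk i') hM.w.symm)
  have : (Over.forget Y).IsLeftAdjoint := (Over.forgetAdjStar Y).isLeftAdjoint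
  exact po''.map (Over.forget Y)

end StablePushouts

/-! ### Representing partial maps by a pushforward along `t` -/

section Classifier

variable {C : Type u} [Category.{v} C] [HasFiniteLimits C]

/-- `P` is the right adjoint applied to `B` over the terminal object, `E` its pullback along `t`,
and `e` the counit. Since `X` is the pullback of `χ` along `t`, maps `X ⟶ B` are the transposes of
maps from `χ` to `p` over `Ω`; `x` is the pullback of `φ`, unique because `j` is mono. -/
theorem exists_pushforward_of_isLeftAdjoint {Ω : C} (t : ⊤_ C ⟶ Ω)
    (ht : (Over.pullback t).IsLeftAdjoint) (B : C) :
    ∃ (P E : C) (p : P ⟶ Ω) (j : E ⟶ P) (e : E ⟶ B), IsPullback j (terminal.from E) p t ∧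
      ∀ ⦃X A : C⦄ (m : X ⟶ A) (χ : A ⟶ Ω) (f : X ⟶ B), IsPullback m (terminal.from X) χ t →
        ∃! φ : A ⟶ P, φ ≫ p = χ ∧ ∃ x : X ⟶ E, x ≫ j = m ≫ φ ∧ x ≫ e = f := by
  let F := Over.pullback t
  let adj := Adjunction.ofIsLeftAdjoint F
  let Q := (F.rightAdjoint).obj (Over.mk (terminal.from B))
  have hE : IsPullback (pullback.fst Q.hom t) (terminal.from _) Q.hom t := by
    rw [Subsingleton.elim (terminal.from _) (pullback.snd Q.hom t)]
    exact IsPullback.of_hasPullback _ _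
  have hF : ∀ {A : C} {χ : A ⟶ Ω} (g : Over.mk χ ⟶ Q),
      (F.map g).left ≫ pullback.fst Q.hom t = pullback.fst χ t ≫ g.left :=
    fun g ↦ Over.pullback_map_left_fst t g
  refine ⟨Q.left, pullback Q.hom t, Q.hom, pullback.fst Q.hom t,
    (adj.counit.app (Over.mk (terminal.from B))).left, hE, ?_⟩
  intro X A m χ f h
  let k : F.obj (Over.mk χ) ⟶ Over.mk (terminal.from B) :=
    Over.homMk (h.isoPullback.inv ≫ f) (Subsingleton.elim _ _)
  have key : ∀ (g : Over.mk χ ⟶ Q), (∃ x : X ⟶ pullback Q.hom t,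
      x ≫ pullback.fst Q.hom t = m ≫ g.left ∧
      x ≫ (adj.counit.app (Over.mk (terminal.from B))).left = f) ↔
      (adj.homEquiv _ _).symm g = k := by
    intro g
    have hx : (h.isoPullback.hom ≫ (F.map g).left) ≫ pullback.fst Q.hom t = m ≫ g.left := by
      rw [Category.assoc, hF]
      simp
    rw [Adjunction.homEquiv_counit]
    constructor
    · rintro ⟨x, h1, h2⟩
      have : x = h.isoPullback.hom ≫ (F.map g).left := by
        rw [← cancel_mono (pullback.fst Q.hom t), h1, hx]
      ext
      simp only [Over.comp_left, k, Over.homMk_left, ← h2, this]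
      simp
    · intro hk
      refine ⟨_, hx, ?_⟩
      have := congrArg CommaMorphism.left hk
      simp only [Over.comp_left, k, Over.homMk_left] at this
      rw [Category.assoc, this]
      simp
  refine ⟨(adj.homEquiv _ _ k).left, ⟨Over.w (adj.homEquiv _ _ k), (key _).2 (by simp)⟩, ?_⟩
  rintro φ ⟨h1, h2⟩
  have := (key (Over.homMk φ h1)).1 h2
  rw [Equiv.symm_apply_eq] at this
  exact congrArg CommaMorphism.left this

/-- Partial maps defined on pullbacks of `t` are representable as soon as pulling back along `t` is
a left adjoint. -/
theorem exists_partialMap_representation {Ω : C} (t : ⊤_ C ⟶ Ω)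
    (ht : (Over.pullback t).IsLeftAdjoint) (B : C) :
    ∃ (P : C) (p : P ⟶ Ω) (η : B ⟶ P), IsPullback η (terminal.from B) p t ∧
      ∀ ⦃X A : C⦄ (m : X ⟶ A) (χ : A ⟶ Ω) (f : X ⟶ B), IsPullback m (terminal.from X) χ t →
        ∃! φ : A ⟶ P, φ ≫ p = χ ∧ f ≫ η = m ≫ φ := by
  obtain ⟨P, E, p, j, e, hE, H⟩ := exists_pushforward_of_isLeftAdjoint t ht B
  have hj : Mono j := ⟨fun a b h ↦ hE.hom_ext h (Subsingleton.elim _ _)⟩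
  have triv : ∀ X : C, IsPullback (𝟙 X) (terminal.from X) (terminal.from X ≫ t) t := fun X ↦
    IsPullback.of_horiz_isIso_mono ⟨by simp⟩
  -- Total maps are the case `m = 𝟙`. Applied to `𝟙 B` this gives a section `s` of `e`; uniqueness
  -- for the total map `e` makes `s` a two-sided inverse, so `E ≅ B`.
  obtain ⟨η, ⟨hp, s, hs, hse⟩, -⟩ := H (𝟙 B) _ (𝟙 B) (triv B)
  rw [Category.id_comp] at hs
  have hes : e ≫ s = 𝟙 E := by
    rw [← cancel_mono j]
    rw [Category.id_comp]
    refine (H (𝟙 E) _ e (triv E)).unique (y₁ := (e ≫ s) ≫ j) (y₂ := j) ⟨?_, e ≫ s, by simp, by simp [hse]⟩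
      ⟨?_, 𝟙 E, by simp, by simp⟩
    · rw [Category.assoc, Category.assoc, reassoc_of% hs, hp, ← Category.assoc]
      exact congrArg (· ≫ t) (Subsingleton.elim _ _)
    · simpa using hE.w
  let i : E ≅ B := ⟨e, s, hes, hse⟩
  have hη : IsPullback η (terminal.from B) p t := by
    refine hE.of_iso i (Iso.refl _) (Iso.refl _) (Iso.refl _) ?_ (Subsingleton.elim _ _)
      (by simp) (by simp)
    simp [i, ← hs, reassoc_of% hes]
  refine ⟨P, p, η, hη, fun X A m χ f h ↦ ?_⟩
  have key : ∀ φ : A ⟶ P, (∃ x : X ⟶ E, x ≫ j = m ≫ φ ∧ x ≫ e = f) ↔ f ≫ η = m ≫ φ := by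
    intro φ
    constructor
    · rintro ⟨x, h1, rfl⟩
      rw [← h1, ← hs, Category.assoc, reassoc_of% hes]
    · intro h1
      exact ⟨f ≫ s, by rw [Category.assoc, hs, h1], by rw [Category.assoc, hse, Category.comp_id]⟩
  simpa only [key] using H m χ f h

omit [HasFiniteLimits C] in
theorem IsRegularMono.of_isPullback {A B D E : C} {m' : A ⟶ D} {f' : A ⟶ B} {f : D ⟶ E}
    {m : B ⟶ E} (h : IsPullback m' f' f m) (hm : IsRegularMono m) : IsRegularMono m' :=
  ⟨⟨regularOfIsPullbackFstOfRegular hm.regularMono.some h.w h.isLimit⟩⟩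

omit [HasFiniteLimits C] in
theorem IsPullback.id_comp_of_mono {X Y Z : C} (x : X ⟶ Y) (j : Y ⟶ Z) [Mono j] :
    IsPullback (𝟙 X) x (x ≫ j) j :=
  IsPullback.of_horiz_isIso_mono ⟨by simp⟩

omit [HasFiniteLimits C] in
/-- A commutative square which becomes a pullback after composing both legs of the cospan with a
common morphism is a pullback. -/
theorem IsPullback.of_postcomp {X Y Z P Q : C} {a : X ⟶ Y} {b : X ⟶ Z} {c : Y ⟶ P} {d : Z ⟶ P}
    {e : P ⟶ Q} (w : a ≫ c = b ≫ d) (h : IsPullback a b (c ≫ e) (d ≫ e)) :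
    IsPullback a b c d :=
  .of_isLimit' ⟨w⟩ <| PullbackCone.IsLimit.mk _
    (fun t ↦ h.lift t.fst t.snd (by simp only [← Category.assoc, t.condition]))
    (fun _ ↦ h.lift_fst _ _ _) (fun _ ↦ h.lift_snd _ _ _)
    (fun t k h₁ h₂ ↦ h.hom_ext (by rw [h₁, h.lift_fst]) (by rw [h₂, h.lift_snd]))

end Classifier

end CategoryTheory

/-! ### Regular monomorphisms and their partial maps in a quasitopos -/

namespace Quasitopos

variable {C : Type u} [Category.{v} C] [Quasitopos C]

instance : HasFiniteLimits C := Quasitopos.hasFiniteLimits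

instance : HasFiniteColimits C := Quasitopos.hasFiniteColimits

theorem exists_partialMapObject (B : C) :
    ∃ (P : C) (η : B ⟶ P), IsRegularMono η ∧ ∀ ⦃X A : C⦄ (m : X ⟶ A) (f : X ⟶ B),
      IsRegularMono m → ∃! φ : A ⟶ P, IsPullback f m η φ := by
  obtain ⟨Ω, t, hΩ⟩ := exists_regularSubobjectClassifier (C := C)
  have ht : IsSplitMono t := terminalIsTerminal.isSplitMono_from t
  obtain ⟨P, p, η, hη, H⟩ := exists_partialMap_representation t (pullback_isLeftAdjoint t) B
  refine ⟨P, η, IsRegularMono.of_isPullback hη inferInstance, fun X A m f hm ↦ ?_⟩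
  have hterm : f ≫ terminal.from B = terminal.from X := Subsingleton.elim _ _
  obtain ⟨χ, hχ, χ_uniq⟩ := hΩ m hm
  obtain ⟨φ, ⟨h₁, h₂⟩, φ_uniq⟩ := H m χ f hχ
  -- By pasting with `hη`, a commutative square on `η` and `ψ` is a pullback exactly when `ψ ≫ p`
  -- classifies `m`.
  refine ⟨φ, ?_, fun ψ hψ ↦ φ_uniq ψ ⟨χ_uniq _ ?_, hψ.w⟩⟩
  · refine IsPullback.of_right ?_ h₂ hη.flip
    rw [hterm, h₁]
    exact hχ.flip
  · simpa only [hterm] using (hψ.paste_horiz hη.flip).flip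

/-- The classifier of partial maps defined on regular subobjects. -/
noncomputable def partialMapClassifier :
    PartialMapClassifier (MorphismProperty.regularMono C) :=
  let P (B : C) : C := (exists_partialMapObject B).choose
  let η (B : C) : B ⟶ P B := (exists_partialMapObject B).choose_spec.choose
  have hη (B : C) : IsRegularMono (η B) := (exists_partialMapObject B).choose_spec.choose_spec.1
  have H {B X A : C} (m : X ⟶ A) (f : X ⟶ B) (hm : IsRegularMono m) :
      ∃! φ : A ⟶ P B, IsPullback f m (η B) φ :=
    (exists_partialMapObject B).choose_spec.choose_spec.2 m f hm
  have hmap {A B : C} (f : A ⟶ B) :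
      IsPullback f (η A) (η B) (H (η A) f (hη A)).choose :=
    (H (η A) f (hη A)).choose_spec.1
  { T :=
      { obj := P
        map := fun {A _} f ↦ (H (η A) f (hη A)).choose
        map_id := fun A ↦ (H (η A) (𝟙 A) (hη A)).unique (hmap _) (IsPullback.id_horiz _)
        map_comp := fun {A _ _} f g ↦ (H (η A) (f ≫ g) (hη A)).unique (hmap _)
          ((hmap f).paste_horiz (hmap g)) }
    η := { app := η, naturality := fun _ _ f ↦ (hmap f).w }
    η_mem := hη
    existsUnique := fun _ _ _ m f hm ↦ H m f hm }

/-- Extend the characteristic map of `f` along `g` to a map into the partial map object of `Ω`. Then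
`f ≫ g` is a pullback of `t ≫ η`, which is split mono because its domain is terminal. -/
theorem isRegularMono_comp {X Y Z : C} (f : X ⟶ Y) (g : Y ⟶ Z) (hf : IsRegularMono f)
    (hg : IsRegularMono g) : IsRegularMono (f ≫ g) := by
  obtain ⟨Ω, t, hΩ⟩ := exists_regularSubobjectClassifier (C := C)
  obtain ⟨χ, hχ, -⟩ := hΩ f hf
  obtain ⟨P, η, -, H⟩ := exists_partialMapObject Ω
  obtain ⟨φ, hφ, -⟩ := H g χ hg
  have : IsSplitMono (t ≫ η) := terminalIsTerminal.isSplitMono_from _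
  exact IsRegularMono.of_isPullback (hχ.paste_horiz hφ.flip) inferInstance

/-! ### Pushouts along regular monomorphisms -/

section Pushouts

variable {X Y Z P : C} {m : X ⟶ Y} {f : X ⟶ Z} {f' : Y ⟶ P} {m' : Z ⟶ P}

/-- The pullback square classifying the partial map `(m, f)` factors through the pushout. -/
theorem isPullback_of_isPushout (po : IsPushout m f f' m') (hm : IsRegularMono m) :
    IsPullback m f f' m' := by
  obtain ⟨Q, η, -, H⟩ := exists_partialMapObject Z
  obtain ⟨φ, hφ, -⟩ := H m f hm
  refine IsPullback.of_postcomp (e := po.desc φ η hφ.w.symm) po.w ?_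
  rw [po.inl_desc, po.inr_desc]
  exact hφ.flip

/-- The classifying square yields `d` with `m' ≫ d = η`. So `m'` is a split mono into the pullback
of `η` along `d`, followed by the projection, itself regular mono as a pullback of `η`. -/
theorem isRegularMono_of_isPushout (po : IsPushout m f f' m') (hm : IsRegularMono m) :
    IsRegularMono m' := by
  obtain ⟨Q, η, hη, H⟩ := exists_partialMapObject Z
  obtain ⟨φ, hφ, -⟩ := H m f hm
  let d := po.desc φ η hφ.w.symm
  have hd : m' ≫ d = η := po.inr_desc _ _ _
  let s : Z ⟶ pullback d η := pullback.lift m' (𝟙 Z) (by simp [hd])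
  have : IsSplitMono s := ⟨⟨pullback.snd d η, pullback.lift_snd _ _ _⟩⟩
  have hs : s ≫ pullback.fst d η = m' := pullback.lift_fst _ _ _
  rw [← hs]
  exact isRegularMono_comp _ _ inferInstance
    (IsRegularMono.of_isPullback (IsPullback.of_hasPullback d η) hη)

end Pushouts

variable (C) in
theorem admitsDPOEncoding : AdmitsDPOEncoding (MorphismProperty.regularMono C) where
  isStableSystemOfMonics :=
    { mono := fun _ _ _ hf ↦ hf.regularMono.some.mono
      of_isIso := fun _ _ f _ ↦ (inferInstance : IsRegularMono f)
      comp := fun _ _ _ f g hf hg ↦ isRegularMono_comp f g hf hg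
      of_isPullback := fun _ _ _ _ _ _ _ _ h hm ↦ IsRegularMono.of_isPullback h hm }
  nonempty_classifier := ⟨partialMapClassifier⟩
  hasPushout := fun _ _ _ _ _ _ ↦ inferInstance
  isPullback_of_isPushout := fun _ _ _ _ _ _ _ _ po hm ↦ isPullback_of_isPushout po hm
  mem_of_isPushout := fun _ _ _ _ _ _ _ _ po hm ↦ isRegularMono_of_isPushout po hm

/-! ### Comparing DPO and PBPO⁺ steps -/

section Step

variable {K L K' L' G_K G_L : C} {l : K ⟶ L} {tK : K ⟶ K'} {tL : L ⟶ L'} {l' : K' ⟶ L'}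
  {u : K ⟶ G_K} {m : L ⟶ G_L} {gL : G_K ⟶ G_L} {u' : G_K ⟶ K'} {α : G_L ⟶ L'}

/-- Let a pushout `top` along `l` map to a pushout `po` along `l`, by the identities on `K` and `L`. If
`u` is the pullback of `tK` along `u'`, then `m` and `α` form a strong match. -/
theorem isStrongMatch_of_isPushout (po : IsPushout l tK tL l') (hl : IsRegularMono l)
    (htK : IsRegularMono tK) (top : IsPushout l u m gL) (hu : IsPullback (𝟙 K) u tK u')
    (hm : m ≫ α = tL) (hgL : gL ≫ α = u' ≫ l') : IsStrongMatch tL m α := by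
  have htL : Mono tL := (isRegularMono_of_isPushout po.flip htK).regularMono.some.mono
  let j : pullback α tL ⟶ G_L := pullback.fst α tL
  let s : L ⟶ pullback α tL := pullback.lift m (𝟙 L) (by simp [hm])
  have hj : s ≫ j = m := pullback.lift_fst _ _ _
  have hs : s ≫ pullback.snd α tL = 𝟙 L := pullback.lift_snd _ _ _
  have hL : IsPullback (𝟙 L) s m j := by
    simpa only [hj] using IsPullback.id_comp_of_mono s j
  have hK : IsPullback (𝟙 K) (l ≫ s) (l ≫ m) j := by
    simpa only [Category.assoc, hj] using IsPullback.id_comp_of_mono (l ≫ s) j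
  have hM : IsPullback u (l ≫ s) gL j := by
    refine (IsPullback.of_right (h₁₂ := pullback.snd α tL) (v₁₃ := tL) (h₂₂ := α) ?_ ?_
      (IsPullback.of_hasPullback α tL).flip).flip
    · simpa only [Category.assoc, hs, hgL, Category.id_comp, Category.comp_id] using
        hu.paste_horiz (isPullback_of_isPushout po hl)
    · rw [Category.assoc, hj, top.w]
  -- Pulling `top` back along `j` keeps `K` and `L` and replaces `G_K` by `K`. So `s` is a pushout
  -- of `𝟙 K`, hence invertible.
  have key : IsPushout l (𝟙 K) s (l ≫ s) :=
    IsPushout.of_isPullback_of_isLeftAdjoint j (pullback_isLeftAdjoint j) top hK hL hM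
      (by simp) (by simp) (by simp)
  have : IsIso s := key.isIso_inl_of_isIso
  exact IsPullback.of_iso_pullback ⟨by simp [hm]⟩ (asIso s) hj hs

theorem exists_adherence_of_isPushout (po : IsPushout l tK tL l') (hl : IsRegularMono l)
    (htK : IsRegularMono tK) (hm : IsRegularMono m) (top : IsPushout l u m gL)
    (H : IsRegularMono u → ∃ u' : G_K ⟶ K', IsPullback (𝟙 K) u tK u') :
    ∃ (α : G_L ⟶ L') (u' : G_K ⟶ K'),
      IsStrongMatch tL m α ∧ IsPullback gL u' α l' ∧ u ≫ u' = tK := by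
  obtain ⟨u', hu'⟩ := H (IsRegularMono.of_isPullback (isPullback_of_isPushout top hl).flip hm)
  have huu' : u ≫ u' = tK := by simpa using hu'.w.symm
  let α : G_L ⟶ L' := top.desc tL (u' ≫ l') (by rw [po.w, reassoc_of% huu'])
  have hα : m ≫ α = tL := top.inl_desc _ _ _
  have hα' : gL ≫ α = u' ≫ l' := top.inr_desc _ _ _
  refine ⟨α, u', isStrongMatch_of_isPushout po hl htK top hu' hα hα', ?_, huu'⟩
  -- Cancelling `top` from `po` leaves a pushout along `gL`, which is regular mono, so it is also a
  -- pullback.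
  have right : IsPushout u' gL l' α := by
    refine IsPushout.of_left ?_ hα'.symm top.flip
    rw [huu', hα]
    exact po.flip
  exact isPullback_of_isPushout right.flip (isRegularMono_of_isPushout top hl)

theorem isPushout_of_isStrongMatch (po : IsPushout l tK tL l') (hl : IsRegularMono l)
    (hα : IsStrongMatch tL m α) (hG : IsPullback gL u' α l') (hu : u ≫ u' = tK) :
    IsPushout l u m gL := by
  have hα₁ : m ≫ α = tL := by simpa using hα.w
  have pb := isPullback_of_isPushout po hl
  let u₀ : K ⟶ G_K := hG.lift (l ≫ m) tK (by rw [Category.assoc, hα₁, po.w])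
  have hu₀ : u₀ ≫ gL = l ≫ m := hG.lift_fst _ _ _
  have hu₀' : u₀ ≫ u' = tK := hG.lift_snd _ _ _
  have h₁ : IsPullback u₀ l gL m := by
    refine IsPullback.of_right ?_ hu₀ hG.flip
    rw [hu₀', hα₁]
    exact pb.flip
  -- This pullback forces every factorization of `tK` through `u'` to be `u₀`; no condition on `u ≫
  -- gL` is needed.
  have h₂ : IsPullback (𝟙 K) u₀ tK u' := by
    refine IsPullback.of_right ?_ (by rw [hu₀', Category.id_comp]) pb
    rw [← hG.w]
    simpa only [Category.id_comp, Category.comp_id] using h₁.flip.paste_horiz hα.flip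
  have huu₀ : u = u₀ := by
    have hx : h₂.lift (𝟙 K) u (by rw [hu, Category.id_comp]) = 𝟙 K := by
      simpa only [Category.comp_id] using h₂.lift_fst (𝟙 K) u (by rw [hu, Category.id_comp])
    rw [← h₂.lift_snd (𝟙 K) u (by rw [hu, Category.id_comp]), hx, Category.id_comp]
  subst huu₀
  exact IsPushout.of_isPullback_of_isLeftAdjoint α (pullback_isLeftAdjoint α) po
    ((IsPullback.id_horiz l).paste_vert hα.flip) hα.flip hG.flip hu₀.symm (by simp) (by simp [hu])

end Step

end Quasitopos

theorem mainTheorem2 (C : Type u) [Category.{v} C] [Quasitopos C] :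
    ∃ h : AdmitsDPOEncoding (MorphismProperty.regularMono C),
      ∀ (c : PartialMapClassifier (MorphismProperty.regularMono C))
        (ρ : DPORule (MorphismProperty.regularMono C)),
        HasPushout ρ.l (c.η.app ρ.K) ∧
        ∀ (L' : C) (tL : ρ.L ⟶ L') (l' : c.T.obj ρ.K ⟶ L')
          (po : IsPushout ρ.l (c.η.app ρ.K) tL l'),
          IsRegularMono tL ∧ IsRegularMono l' ∧
          ∀ (G_L : C) (m : ρ.L ⟶ G_L), IsRegularMono m →
            ∀ G_R : C, ρ.Step m G_R ↔ (ρ.toPBPOPlus h c po).Step m G_R := by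
  refine ⟨Quasitopos.admitsDPOEncoding C, fun c ρ ↦ ⟨inferInstance, fun L' tL l' po ↦
    ⟨Quasitopos.isRegularMono_of_isPushout po.flip (c.η_mem ρ.K),
      Quasitopos.isRegularMono_of_isPushout po ρ.l_mem, fun G_L m hm G_R ↦ ⟨?_, ?_⟩⟩⟩⟩
  · rintro ⟨G_K, u, gL, gR, w, top, right⟩
    obtain ⟨α, u', h₁, h₂, h₃⟩ := Quasitopos.exists_adherence_of_isPushout po ρ.l_mem
      (c.η_mem ρ.K) hm top fun hu ↦ (c.existsUnique u (𝟙 ρ.K) hu).exists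
    exact ⟨α, h₁, G_K, gL, u', u, gR, w, h₂, h₃, right⟩
  · rintro ⟨α, h₁, G_K, gL, u', u, gR, w, h₂, h₃, right⟩
    exact ⟨G_K, u, gL, gR, w, Quasitopos.isPushout_of_isStrongMatch po ρ.l_mem h₁ h₂ h₃, right⟩
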